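/- Let $\Bbbk$ be an algebraically closed field of characteristic $0$, and let $X$ be a finite set with $|X|\ge 2$. Let $r:X\times X\to X\times X$, written $r(i,j)=(\sigma_i(j),\tau_j(i))$, be a non-degenerate involutive set-theoretical solution of the Yang–Baxter equation; that is, $r$ is bijective, $(r\times\mathrm{id})(\mathrm{id}\times r)(r\times\mathrm{id})=(\mathrm{id}\times r)(r\times\mathrm{id})(\mathrm{id}\times r)$, all $\sigma_i$ and $\tau_i$ are bijective, and $r^2=\mathrm{id}$. Let $D:X\to X$, $D(i)=\tau_i^{-1}(i)$, be its diagonal. Let $(R_{i,j})_{i,j\in X}$ be elements of $\Bbbk^\times$ such that for all $i,j,k\in X$ $$R_{i,j}R_{\tau_j(i),k}R_{\sigma_i(j),\sigma_{\tau_j(i)}(k)}=R_{j,k}R_{i,\sigma_j(k)}R_{\tau_{\sigma_j(k)}(i),\tau_k(j)},$$ and let $W_{X,r}=\bigoplus_{i\in X}\Bbbk w_i$ be the braided vector space with braiding $c(w_i\otimes w_j)=R_{i,j}\,w_{\sigma_i(j)}\otimes w_{\tau_j(i)}$. Let $\mathfrak B(W_{X,r})=T(W_{X,r})/\bigoplus_{n\ge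 0}\ker\mathfrak S_n$ be its Nichols algebra. Here $\mathfrak S_n$ is the quantum symmetrizer on $W_{X,r}^{\otimes n}$, given by $\mathfrak S_0=\mathrm{id}$ and $\mathfrak S_{n+1}=\mathfrak S_{n,1}(\mathfrak S_n\otimes\mathrm{id})$, where $\mathfrak S_{n,1}=\mathrm{id}+c_n+c_{n-1}c_n+\cdots+c_1\cdots c_{n-1}c_n$ and $c_i$ is $c$ acting on the tensor factors $i,i+1$. Suppose $X=X_1\cup\cdots\cup X_t$ is a disjoint union of non-empty subsets with $r(X_k\times X_k)\subseteq X_k\times X_k$ for every $k$. Suppose that for each $k$ there are an integer $n_k\ge 2$ and a primitive $n_k$-th root of unity $q_k\in\Bbbk$ such that $R_{D(i),i}=q_k$ for all $i\in X_k$, and that $R_{i,j}R_{\sigma_i(j),\tau_j(i)}=1$ for all $i,j\in X$ with $i\ne D(j)$. Then $\mathfrak B(W_{X,r})$ is finite-dimensional and $$\dim\mathfrak B(W_{X,r})=\prod_{k=1}^t n_k^{|X_k|}.$$ -/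

import Mathlib

open scoped TensorProduct DirectSum

/-! ### Set-theoretical solutions of the Yang-Baxter equation -/

namespace SetYB

variable {X : Type*}

/-- The first component `σ_i(j)` of `r(i, j) = (σ_i(j), τ_j(i))`. -/
def sigma (r : X × X → X × X) (i j : X) : X := (r (i, j)).1

/-- The second component `τ_j(i)` of `r(i, j) = (σ_i(j), τ_j(i))`; the subscript comes first. -/
def tau (r : X × X → X × X) (j i : X) : X := (r (i, j)).2

/-- The map `r × id` on `X × X × X`. -/
def r12 (r : X × X → X × X) (p : X × X × X) : X × X × X :=
  ((r (p.1, p.2.1)).1, (r (p.1, p.2.1)).2, p.2.2)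

/-- The map `id × r` on `X × X × X`. -/
def r23 (r : X × X → X × X) (p : X × X × X) : X × X × X :=
  (p.1, r p.2)

/-- `(X, r)` is a set-theoretical solution of the Yang-Baxter equation. -/
structure IsSolution (r : X × X → X × X) : Prop where
  nonempty : Nonempty X
  bijective : Function.Bijective r
  yang_baxter : ∀ p : X × X × X, r12 r (r23 r (r12 r p)) = r23 r (r12 r (r23 r p))

/-- All the maps `σ_i` and `τ_i` are bijective. -/
structure IsNonDegenerate (r : X × X → X × X) : Prop where
  sigma_bijective : ∀ i, Function.Bijective (sigma r i)
  tau_bijective : ∀ i, Function.Bijective (tau r i)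

/-- `r² = id`. -/
def IsInvolutive (r : X × X → X × X) : Prop := ∀ p, r (r p) = p

/-- The diagonal `D(i) = τ_i⁻¹(i)` of a non-degenerate solution. -/
noncomputable def diagonal {r : X × X → X × X} (h : IsNonDegenerate r) (i : X) : X :=
  (Equiv.ofBijective (tau r i) (h.tau_bijective i)).symm i

/-- `X` is the disjoint union of the non-empty subsets `Y 0, …, Y (t - 1)`, and
`r (Y k × Y k) ⊆ Y k × Y k` for every `k`. -/
structure IsDecomposition (r : X × X → X × X) {t : ℕ} (Y : Fin t → Finset X) : Prop where
  nonempty : ∀ k, (Y k).Nonempty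
  disjoint : ∀ k l, k ≠ l → Disjoint (Y k) (Y l)
  cover : ∀ i : X, ∃ k, i ∈ Y k
  closed : ∀ k, ∀ i ∈ Y k, ∀ j ∈ Y k, (r (i, j)).1 ∈ Y k ∧ (r (i, j)).2 ∈ Y k

/-- The conditions on the scalars `R_{i,j}` under which
`w_i ⊗ w_j ↦ R_{i,j} w_{σ_i(j)} ⊗ w_{τ_j(i)}` is a braiding: they are non-zero and
`R_{i,j} R_{τ_j(i),k} R_{σ_i(j),σ_{τ_j(i)}(k)}
  = R_{j,k} R_{i,σ_j(k)} R_{τ_{σ_j(k)}(i),τ_k(j)}`. -/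
structure IsBraidingCoeff {𝕜 : Type*} [Field 𝕜] (r : X × X → X × X) (R : X → X → 𝕜) : Prop where
  ne_zero : ∀ i j, R i j ≠ 0
  braid : ∀ i j k,
    R i j * R (tau r j i) k * R (sigma r i j) (sigma r (tau r j i) k) =
      R j k * R i (sigma r j k) * R (tau r (sigma r j k) i) (tau r k j)

/-- The braiding `c(w_i ⊗ w_j) = R_{i,j} w_{σ_i(j)} ⊗ w_{τ_j(i)}` of the vector space
`W_{X,r} = X →₀ 𝕜`, whose basis vectors are `w_i = Finsupp.single i 1`. -/
noncomputable def braiding {𝕜 : Type*} [Field 𝕜] (r : X × X → X × X) (R : X → X → 𝕜) :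
    ((X →₀ 𝕜) ⊗[𝕜] (X →₀ 𝕜)) →ₗ[𝕜] ((X →₀ 𝕜) ⊗[𝕜] (X →₀ 𝕜)) :=
  TensorProduct.lift <| Finsupp.linearCombination 𝕜 fun i =>
    Finsupp.linearCombination 𝕜 fun j =>
      R i j • (Finsupp.single (sigma r i j) (1 : 𝕜) ⊗ₜ[𝕜] Finsupp.single (tau r j i) (1 : 𝕜))

end SetYB

/-! ### The Nichols algebra of a braided vector space -/

namespace Nichols

variable {𝕜 V : Type*} [Field 𝕜] [AddCommGroup V] [Module 𝕜 V]

/-- The canonical identification `V^{⊗n} ⊗ V = V^{⊗(n+1)}`. -/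
noncomputable def snocEquiv (𝕜 V : Type*) [Field 𝕜] [AddCommGroup V] [Module 𝕜 V] (n : ℕ) :
    ((⨂[𝕜]^n V) ⊗[𝕜] V) ≃ₗ[𝕜] (⨂[𝕜]^(n + 1) V) :=
  (LinearEquiv.lTensor (⨂[𝕜]^n V)
    (PiTensorProduct.subsingletonEquiv (R := 𝕜) (s := fun _ : Fin 1 => V) 0).symm) ≪≫ₗ
    TensorPower.mulEquiv

/-- For `f` an endomorphism of `V^{⊗n}`, the endomorphism `f ⊗ id` of `V^{⊗(n+1)}`. -/
noncomputable def extend {n : ℕ} (f : Module.End 𝕜 (⨂[𝕜]^n V)) :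
    Module.End 𝕜 (⨂[𝕜]^(n + 1) V) :=
  (snocEquiv 𝕜 V n).conj (LinearMap.rTensor V f)

/-- The endomorphism `id^{⊗n} ⊗ c` of `V^{⊗(n+2)}`. -/
noncomputable def lastBraid (c : Module.End 𝕜 (V ⊗[𝕜] V)) (n : ℕ) :
    Module.End 𝕜 (⨂[𝕜]^(n + 2) V) :=
  ((TensorProduct.assoc 𝕜 (⨂[𝕜]^n V) V V).symm ≪≫ₗ
      LinearEquiv.rTensor V (snocEquiv 𝕜 V n) ≪≫ₗ snocEquiv 𝕜 V (n + 1)).conj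
    (LinearMap.lTensor (⨂[𝕜]^n V) c)

/-- The operator `𝔖_{n,1} = id + c_n + c_{n-1} c_n + ⋯ + c_1 ⋯ c_{n-1} c_n` on `V^{⊗(n+1)}`,
by the recursion `𝔖_{n+1,1} = id + (𝔖_{n,1} ⊗ id) c_{n+1}`. -/
noncomputable def shuffleOp (c : Module.End 𝕜 (V ⊗[𝕜] V)) :
    (n : ℕ) → Module.End 𝕜 (⨂[𝕜]^(n + 1) V)
  | 0 => LinearMap.id
  | n + 1 => LinearMap.id + extend (shuffleOp c n) ∘ₗ lastBraid c n

/-- The quantum symmetrizer `𝔖_n` on `V^{⊗n}`: `𝔖_0 = id` and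
`𝔖_{n+1} = 𝔖_{n,1} (𝔖_n ⊗ id)`; in particular `𝔖_1 = id` and `𝔖_2 = id + c`. -/
noncomputable def symmetrizer (c : Module.End 𝕜 (V ⊗[𝕜] V)) :
    (n : ℕ) → Module.End 𝕜 (⨂[𝕜]^n V)
  | 0 => LinearMap.id
  | n + 1 => shuffleOp c n ∘ₗ extend (symmetrizer c n)

/-- The subspace `ker 𝔖 = ⨁ₙ ker 𝔖_n` of the tensor algebra `T(V) = ⨁ₙ V^{⊗n}`. -/
noncomputable def kernel (c : Module.End 𝕜 (V ⊗[𝕜] V)) : Submodule 𝕜 (TensorAlgebra 𝕜 V) :=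
  LinearMap.ker ((DirectSum.lmap fun n => symmetrizer c n) ∘ₗ
    (TensorAlgebra.equivDirectSum (R := 𝕜) (M := V)).toLinearMap)

/-- (The underlying vector space of) the Nichols algebra `𝔅(V, c) = T(V) / ker 𝔖` of the
braided vector space `(V, c)`. -/
abbrev NicholsAlgebra (c : Module.End 𝕜 (V ⊗[𝕜] V)) : Type _ :=
  TensorAlgebra 𝕜 V ⧸ kernel c

end Nichols

/-! Give the word `x_1 ⋯ x_n` its guitar coordinates `y_k = σ_{x_1} ⋯ σ_{x_{k-1}} (x_k)`. In them
`r`, applied to two neighbours, merely interchanges `y_i` and `y_{i+1}`, so up to non-zero scalars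
the braid group permutes words as it does for a quantum linear space (`strand_guitarBasis`). Equal
coordinates occur exactly at fixed pairs of `r`, where the eigenvalue is `R_{D(x),x}` for the common
coordinate `x`; on distinct coordinates `c² = id`.

The rest concerns any such action. The symmetrizer is divisible on the right by each `1 + T_i`
(`exists_symmSum_eq`), so it sends a word and its transposed word to proportional vectors: its image
is spanned by one vector per content, that is, per vector of letter multiplicities. If the letter
`x` occurs at least `N x` times, with `N x` the order of its eigenvalue, a factor `[N x]_q = 0`
kills the vector (`symmSum_eq_zero`). Otherwise the diagonal coefficient at a word with equal
letters grouped is a product of non-zero quantum integers (`repr_symmSum_ne_zero`). Vectors of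
different contents have disjoint supports, hence are independent. The dimension is therefore the
number of contents with every multiplicity below `N x`, namely `∏ N x`. -/

namespace Nichols

/-! ### Divisibility of the symmetrizer in a ring with braid relations -/

section BraidFamily

variable {A : Type*} [Ring A]

/-- The element `1 + T_{m-1} + T_{m-2} T_{m-1} + ⋯ + T_0 ⋯ T_{m-1}`. -/
def shuffleSum (T : ℕ → A) : ℕ → A
  | 0 => 1
  | m + 1 => 1 + shuffleSum T m * T m

/-- The quantum symmetrizer on `m` strands attached to a sequence of ring elements. -/
def symmSum (T : ℕ → A) : ℕ → A
  | 0 => 1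
  | m + 1 => shuffleSum T m * symmSum T m

/-- The relations of the braid group on infinitely many strands. -/
structure IsBraidFamily (T : ℕ → A) : Prop where
  comm : ∀ i j, i + 2 ≤ j → T i * T j = T j * T i
  braid : ∀ i, T i * T (i + 1) * T i = T (i + 1) * T i * T (i + 1)

theorem IsBraidFamily.commute_shuffleSum {T : ℕ → A} (hT : IsBraidFamily T) {m j : ℕ}
    (h : m + 1 ≤ j) : Commute (shuffleSum T m) (T j) := by
  induction m with
  | zero => exact Commute.one_left _
  | succ m ih =>
    exact (Commute.one_left _).add_left
      ((ih (by omega)).mul_left (hT.comm m j (by omega)))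

theorem IsBraidFamily.commute_symmSum {T : ℕ → A} (hT : IsBraidFamily T) {m j : ℕ}
    (h : m ≤ j) : Commute (symmSum T m) (T j) := by
  induction m with
  | zero => exact Commute.one_left _
  | succ m ih => exact (hT.commute_shuffleSum h).mul_left (ih (by omega))

/-- In the inductive step `T (m + 1)` commutes past `shuffleSum T m`, and the braid relation turns
`(1 + T m) T (m + 1) T m` into `T (m + 1) T m (1 + T (m + 1))`. -/
theorem IsBraidFamily.exists_shuffleSum_mul_shuffleSum {T : ℕ → A} (hT : IsBraidFamily T)
    (m : ℕ) : ∃ B, shuffleSum T (m + 1) * shuffleSum T m = B * (1 + T m) := by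
  induction m with
  | zero => exact ⟨1, by simp [shuffleSum]⟩
  | succ m ih =>
    obtain ⟨B, hB⟩ := ih
    refine ⟨shuffleSum T (m + 1) + B * (T (m + 1) * T m), ?_⟩
    have hc : T (m + 1) * shuffleSum T m = shuffleSum T m * T (m + 1) :=
      (hT.commute_shuffleSum le_rfl).symm.eq
    calc shuffleSum T (m + 2) * shuffleSum T (m + 1)
        = shuffleSum T (m + 1) + shuffleSum T (m + 1) * T (m + 1) * shuffleSum T (m + 1) := by
          rw [shuffleSum, add_mul, one_mul]
      _ = shuffleSum T (m + 1)
            + shuffleSum T (m + 1) * T (m + 1) * (1 + shuffleSum T m * T m) := rfl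
      _ = shuffleSum T (m + 1) * (1 + T (m + 1))
            + shuffleSum T (m + 1) * (T (m + 1) * shuffleSum T m) * T m := by noncomm_ring
      _ = shuffleSum T (m + 1) * (1 + T (m + 1))
            + (shuffleSum T (m + 1) * shuffleSum T m) * (T (m + 1) * T m) := by
          rw [hc]; noncomm_ring
      _ = shuffleSum T (m + 1) * (1 + T (m + 1))
            + B * (T (m + 1) * T m + T m * T (m + 1) * T m) := by rw [hB]; noncomm_ring
      _ = _ := by rw [hT.braid]; noncomm_ring

/-- Consequently `symmSum T m` takes the same value on `v` and `T i v` whenever `T i (T i v) = v`.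
-/
theorem IsBraidFamily.exists_symmSum_eq {T : ℕ → A} (hT : IsBraidFamily T) {i m : ℕ}
    (h : i + 1 < m) : ∃ B, symmSum T m = B * (1 + T i) := by
  induction m with
  | zero => omega
  | succ m ih =>
    rcases Nat.lt_or_ge (i + 1) m with h' | h'
    · obtain ⟨B, hB⟩ := ih h'
      exact ⟨shuffleSum T m * B, by rw [symmSum, hB, mul_assoc]⟩
    · obtain rfl : m = i + 1 := by omega
      obtain ⟨B, hB⟩ := hT.exists_shuffleSum_mul_shuffleSum i
      refine ⟨B * symmSum T i, ?_⟩
      have hc : Commute (symmSum T i) (1 + T i) :=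
        (Commute.one_right _).add_right (hT.commute_symmSum le_rfl)
      rw [symmSum, symmSum, ← mul_assoc, hB, mul_assoc, mul_assoc, hc.eq]

end BraidFamily

/-! ### Subspaces preserved by the symmetrizer -/

section Stable

variable {𝕜 M : Type*} [Field 𝕜] [AddCommGroup M] [Module 𝕜 M]

theorem shuffleSum_mem {T : ℕ → Module.End 𝕜 M} {P : Submodule 𝕜 M} {m : ℕ}
    (h : ∀ i < m, ∀ v ∈ P, T i v ∈ P) {v : M} (hv : v ∈ P) : shuffleSum T m v ∈ P := by
  induction m generalizing v with
  | zero => exact hv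
  | succ m ih =>
    exact P.add_mem hv (ih (fun i hi => h i (by omega)) (h m (by omega) v hv))

theorem symmSum_mem {T : ℕ → Module.End 𝕜 M} {P : Submodule 𝕜 M} {m : ℕ}
    (h : ∀ i, i + 1 < m → ∀ v ∈ P, T i v ∈ P) {v : M} (hv : v ∈ P) : symmSum T m v ∈ P := by
  induction m with
  | zero => exact hv
  | succ m ih =>
    exact shuffleSum_mem (fun i hi => h i (by omega)) (ih fun i hi => h i (by omega))

end Stable

/-! ### The braid group acting on a fixed tensor power -/

section Strands

variable {𝕜 V : Type*} [Field 𝕜] [AddCommGroup V] [Module 𝕜 V]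

theorem extend_snoc {n : ℕ} (f : Module.End 𝕜 (⨂[𝕜]^n V)) (u : ⨂[𝕜]^n V) (v : V) :
    extend f (snocEquiv 𝕜 V n (u ⊗ₜ v)) = snocEquiv 𝕜 V n (f u ⊗ₜ v) := by
  simp [extend, LinearEquiv.conj_apply_apply]

theorem end_ext_snoc {n : ℕ} {f g : Module.End 𝕜 (⨂[𝕜]^(n + 1) V)}
    (h : ∀ u v, f (snocEquiv 𝕜 V n (u ⊗ₜ v)) = g (snocEquiv 𝕜 V n (u ⊗ₜ v))) : f = g := by
  have : f ∘ₗ (snocEquiv 𝕜 V n).toLinearMap = g ∘ₗ (snocEquiv 𝕜 V n).toLinearMap :=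
    TensorProduct.ext' h
  ext1
  ext x
  obtain ⟨y, hy⟩ := (snocEquiv 𝕜 V n).surjective (PiTensorProduct.tprod 𝕜 x)
  simpa [hy] using LinearMap.congr_fun this y

/-- `f ↦ f ⊗ id` as a ring homomorphism. -/
noncomputable def extendHom (𝕜 V : Type*) [Field 𝕜] [AddCommGroup V] [Module 𝕜 V] (n : ℕ) :
    Module.End 𝕜 (⨂[𝕜]^n V) →+* Module.End 𝕜 (⨂[𝕜]^(n + 1) V) where
  toFun := extend
  map_one' := end_ext_snoc fun u v => by rw [extend_snoc]; rfl
  map_mul' f g := end_ext_snoc fun u v => by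
    rw [extend_snoc, Module.End.mul_apply, Module.End.mul_apply, extend_snoc, extend_snoc]
  map_zero' := end_ext_snoc fun u v => by rw [extend_snoc]; simp
  map_add' f g := end_ext_snoc fun u v => by
    rw [extend_snoc, LinearMap.add_apply, LinearMap.add_apply, extend_snoc, extend_snoc,
      TensorProduct.add_tmul, map_add]

theorem extendHom_snoc {n : ℕ} (f : Module.End 𝕜 (⨂[𝕜]^n V)) (u : ⨂[𝕜]^n V) (v : V) :
    extendHom 𝕜 V n f (snocEquiv 𝕜 V n (u ⊗ₜ v)) = snocEquiv 𝕜 V n (f u ⊗ₜ v) :=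
  extend_snoc f u v

/-- The canonical map `V^{⊗n} ⊗ (V ⊗ V) → V^{⊗(n+2)}`. -/
noncomputable def snocTwo {n : ℕ} (u : ⨂[𝕜]^n V) : V ⊗[𝕜] V →ₗ[𝕜] ⨂[𝕜]^(n + 2) V :=
  ((TensorProduct.assoc 𝕜 (⨂[𝕜]^n V) V V).symm ≪≫ₗ
      LinearEquiv.rTensor V (snocEquiv 𝕜 V n) ≪≫ₗ snocEquiv 𝕜 V (n + 1)).toLinearMap ∘ₗ
    TensorProduct.mk 𝕜 _ _ u

theorem snocTwo_tmul {n : ℕ} (u : ⨂[𝕜]^n V) (v w : V) :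
    snocTwo u (v ⊗ₜ w) = snocEquiv 𝕜 V (n + 1) (snocEquiv 𝕜 V n (u ⊗ₜ v) ⊗ₜ w) := by
  simp [snocTwo]

theorem lastBraid_snocTwo (c : Module.End 𝕜 (V ⊗[𝕜] V)) {n : ℕ} (u : ⨂[𝕜]^n V)
    (x : V ⊗[𝕜] V) : lastBraid c n (snocTwo u x) = snocTwo u (c x) := by
  rw [lastBraid, LinearEquiv.conj_apply_apply, snocTwo, LinearMap.comp_apply,
    LinearEquiv.coe_coe, LinearEquiv.symm_apply_apply]
  rfl

theorem extend_extend_snocTwo {n : ℕ} (f : Module.End 𝕜 (⨂[𝕜]^n V)) (u : ⨂[𝕜]^n V)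
    (x : V ⊗[𝕜] V) :
    extendHom 𝕜 V (n + 1) (extendHom 𝕜 V n f) (snocTwo u x) = snocTwo (f u) x := by
  induction x with
  | zero => simp
  | add x y hx hy => simp only [map_add, hx, hy]
  | tmul v w => simp only [snocTwo_tmul, extendHom_snoc]

theorem commute_extend_extend_lastBraid (c : Module.End 𝕜 (V ⊗[𝕜] V)) {n : ℕ}
    (f : Module.End 𝕜 (⨂[𝕜]^n V)) :
    extendHom 𝕜 V (n + 1) (extendHom 𝕜 V n f) * lastBraid c n =
      lastBraid c n * extendHom 𝕜 V (n + 1) (extendHom 𝕜 V n f) := by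
  refine end_ext_snoc fun u v => ?_
  obtain ⟨u, rfl⟩ := (snocEquiv 𝕜 V n).surjective u
  induction u with
  | zero => simp
  | add x y hx hy => simp only [map_add, TensorProduct.add_tmul, hx, hy]
  | tmul u w =>
    rw [← snocTwo_tmul, Module.End.mul_apply, Module.End.mul_apply, lastBraid_snocTwo,
      extend_extend_snocTwo, extend_extend_snocTwo, lastBraid_snocTwo]

/-- The braiding `c` acting on the adjacent factors `i, i + 1` (counted from `0`) of `V^{⊗n}`;
it is `0` when there are no such factors. -/
noncomputable def strand (c : Module.End 𝕜 (V ⊗[𝕜] V)) :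
    (n : ℕ) → ℕ → Module.End 𝕜 (⨂[𝕜]^n V)
  | 0, _ => 0
  | 1, _ => 0
  | n + 2, i => if i = n then lastBraid c n else extendHom 𝕜 V (n + 1) (strand c (n + 1) i)

theorem strand_last (c : Module.End 𝕜 (V ⊗[𝕜] V)) (n : ℕ) :
    strand c (n + 2) n = lastBraid c n := by
  simp [strand]

theorem strand_succ (c : Module.End 𝕜 (V ⊗[𝕜] V)) {n i : ℕ} (h : i + 1 ≠ n) :
    strand c (n + 1) i = extendHom 𝕜 V n (strand c n i) := by
  cases n with
  | zero => simp [strand]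
  | succ n => rw [strand, if_neg (by omega)]

theorem strand_eq_zero (c : Module.End 𝕜 (V ⊗[𝕜] V)) {n i : ℕ} (h : n ≤ i + 1) :
    strand c n i = 0 := by
  induction n with
  | zero => rfl
  | succ n ih => rw [strand_succ c (by omega), ih (by omega), map_zero]

theorem strand_comm (c : Module.End 𝕜 (V ⊗[𝕜] V)) (n : ℕ) {i j : ℕ} (h : i + 2 ≤ j) :
    strand c n i * strand c n j = strand c n j * strand c n i := by
  induction n with
  | zero => simp [strand]
  | succ n ih =>
    rcases lt_trichotomy (j + 1) n with hj | hj | hj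
    · rw [strand_succ c (by omega), strand_succ c (by omega), ← map_mul, ih, map_mul]
    · subst hj
      rw [strand_last, strand_succ c (by omega), strand_succ c (by omega),
        commute_extend_extend_lastBraid]
    · rw [strand_eq_zero c (show n + 1 ≤ j + 1 by omega), mul_zero, zero_mul]

/-- The braid relation is needed only on the last three factors; appending factors transports it,
and out-of-range strands are `0`. -/
theorem isBraidFamily_strand (c : Module.End 𝕜 (V ⊗[𝕜] V))
    (hc : ∀ n, extendHom 𝕜 V (n + 2) (lastBraid c n) * lastBraid c (n + 1) *
        extendHom 𝕜 V (n + 2) (lastBraid c n) =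
      lastBraid c (n + 1) * extendHom 𝕜 V (n + 2) (lastBraid c n) * lastBraid c (n + 1))
    (n : ℕ) : IsBraidFamily (strand c n) where
  comm _ _ h := strand_comm c n h
  braid i := by
    induction n with
    | zero => simp [strand]
    | succ n ih =>
      rcases lt_trichotomy (i + 2) n with hi | hi | hi
      · rw [strand_succ c (by omega), strand_succ c (by omega), ← map_mul, ← map_mul, ih,
          map_mul, map_mul]
      · subst hi
        rw [strand_last, strand_succ c (by omega), strand_last, hc]
      · rw [strand_eq_zero c (show n + 1 ≤ i + 1 + 1 by omega)]
        simp

theorem map_shuffleSum {A B : Type*} [Ring A] [Ring B] (f : A →+* B) {T : ℕ → A} {T' : ℕ → B}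
    {m : ℕ} (h : ∀ i < m, f (T i) = T' i) : f (shuffleSum T m) = shuffleSum T' m := by
  induction m with
  | zero => exact map_one f
  | succ m ih =>
    rw [shuffleSum, shuffleSum, map_add, map_one, map_mul, h m (by omega),
      ih fun i hi => h i (by omega)]

theorem map_symmSum {A B : Type*} [Ring A] [Ring B] (f : A →+* B) {T : ℕ → A} {T' : ℕ → B}
    {m : ℕ} (h : ∀ i, i + 1 < m → f (T i) = T' i) : f (symmSum T m) = symmSum T' m := by
  induction m with
  | zero => exact map_one f
  | succ m ih =>
    rw [symmSum, symmSum, map_mul, map_shuffleSum f fun i hi => h i (by omega),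
      ih fun i hi => h i (by omega)]

theorem shuffleOp_eq (c : Module.End 𝕜 (V ⊗[𝕜] V)) (n : ℕ) :
    shuffleOp c n = shuffleSum (strand c (n + 1)) n := by
  induction n with
  | zero => rfl
  | succ n ih =>
    rw [shuffleOp, shuffleSum, strand_last, ih]
    change 1 + extendHom 𝕜 V (n + 1) _ * _ = _
    rw [map_shuffleSum (extendHom 𝕜 V (n + 1)) fun i hi => (strand_succ c (by omega)).symm]

/-- This replaces a recursion through varying tensor powers by one inside a single endomorphism
ring, where the divisibility results apply. -/
theorem symmetrizer_eq (c : Module.End 𝕜 (V ⊗[𝕜] V)) (n : ℕ) :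
    symmetrizer c n = symmSum (strand c n) n := by
  induction n with
  | zero => rfl
  | succ n ih =>
    rw [symmetrizer, symmSum, shuffleOp_eq, ih]
    change _ * extendHom 𝕜 V n _ = _
    rw [map_symmSum (extendHom 𝕜 V n) fun i hi => (strand_succ c (by omega)).symm]

end Strands

end Nichols

namespace Nichols

/-! ### Words, their contents and grouped rearrangements -/

section Words

variable {X : Type*} {n : ℕ}

/-- The number of occurrences of each letter in a word. -/
noncomputable def content (y : Fin n → X) (x : X) : ℕ := Nat.card {i // y i = x}

/-- Equal letters of the word occupy consecutive positions. -/
def IsGrouped (y : Fin n → X) : Prop := ∀ i j k, i ≤ j → j ≤ k → y i = y k → y j = y i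

theorem content_comp_perm (y : Fin n → X) (w : Equiv.Perm (Fin n)) :
    content (y ∘ w) = content y :=
  funext fun _ => Nat.card_congr (w.subtypeEquiv fun _ => Iff.rfl)

theorem sum_content [Fintype X] (y : Fin n → X) : ∑ x, content y x = n := by
  classical
  have : ∑ x, Fintype.card {i // y i = x} = n := by
    rw [← Fintype.card_sigma, Fintype.card_congr (Equiv.sigmaFiberEquiv y), Fintype.card_fin]
  simpa only [content, Nat.card_eq_fintype_card] using this

theorem exists_perm_of_content_eq {y z : Fin n → X} (h : content y = content z) :
    ∃ w : Equiv.Perm (Fin n), y = z ∘ w := by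
  let e : ∀ x, {i // y i = x} ≃ {i // z i = x} := fun x => (Finite.card_eq.mp (congrFun h x)).some
  exact ⟨Equiv.ofFiberEquiv e, funext fun i => (Equiv.ofFiberEquiv_map e i).symm⟩

theorem exists_perm_isGrouped [Fintype X] (y : Fin n → X) :
    ∃ w : Equiv.Perm (Fin n), IsGrouped (y ∘ w) := by
  let f := Fintype.equivFin X
  have hm : Monotone ((f ∘ y) ∘ Tuple.sort (f ∘ y)) := Tuple.monotone_sort _
  refine ⟨Tuple.sort (f ∘ y), fun i j k hij hjk h => f.injective (le_antisymm ?_ (hm hij))⟩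
  rw [h]
  exact hm hjk

theorem exists_perm_of_le_content (y : Fin n → X) (x : X) {N : ℕ} (h : N ≤ content y x) :
    ∃ w : Equiv.Perm (Fin n), ∀ i : Fin n, (i : ℕ) < N → (y ∘ w) i = x := by
  classical
  -- Sorting by this key moves all copies of `x` to the front.
  let f : X → ℕ := fun z => if z = x then 0 else 1
  have hm : Monotone ((f ∘ y) ∘ Tuple.sort (f ∘ y)) := Tuple.monotone_sort _
  refine ⟨Tuple.sort (f ∘ y), fun i hi => ?_⟩
  set z := y ∘ Tuple.sort (f ∘ y) with hz
  by_contra hne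
  have hlt : ∀ j, z j = x → j < i := by
    intro j hj
    by_contra hle
    have h1 : f (z i) ≤ f (z j) := hm (not_lt.mp hle)
    simp [f, hne, hj] at h1
  have hc : content z x ≤ i := by
    have := Nat.card_le_card_of_injective
      (fun j : {j // z j = x} => (⟨j.1, hlt j.1 j.2⟩ : Fin i)) (by
        intro a b hab
        apply Subtype.ext
        apply Fin.ext
        simpa using hab)
    simpa [content] using this
  rw [hz, content_comp_perm] at hc
  omega

theorem exists_isGrouped_content_eq [Fintype X] (μ : X → ℕ) :
    ∃ p : Σ n, Fin n → X, IsGrouped p.2 ∧ content p.2 = μ := by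
  classical
  have e : Fin (∑ x, μ x) ≃ Σ x, Fin (μ x) := (Fintype.equivFinOfCardEq (by simp)).symm
  obtain ⟨w, hw⟩ := exists_perm_isGrouped (fun i => (e i).1)
  refine ⟨⟨∑ x, μ x, (fun i => (e i).1) ∘ w⟩, hw,
    (content_comp_perm (fun i => (e i).1) w).trans ?_⟩
  funext x
  have e' : {i // (e i).1 = x} ≃ Fin (μ x) :=
    (e.subtypeEquiv fun _ => Iff.rfl).trans (Equiv.sigmaSubtype x)
  rw [content, Nat.card_congr e', Nat.card_fin]

theorem count_le_content (y : Fin n → X) (x : X) (m : ℕ)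
    [DecidablePred fun j => ∃ h : j < n, y ⟨j, h⟩ = x] :
    Nat.count (fun j => ∃ h : j < n, y ⟨j, h⟩ = x) m ≤ content y x := by
  rw [Nat.count_eq_card_filter_range, ← Fintype.card_coe, ← Nat.card_eq_fintype_card]
  refine Nat.card_le_card_of_injective
    (fun k => ⟨⟨k.1, (Finset.mem_filter.mp k.2).2.1⟩, (Finset.mem_filter.mp k.2).2.2⟩)
    fun a b hab => ?_
  apply Subtype.ext
  simpa using hab

end Words

/-! ### Symmetrizers of actions that swap adjacent letters -/

section SwapAction

variable {𝕜 M X : Type*} [Field 𝕜] [AddCommGroup M] [Module 𝕜 M] {n : ℕ}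

/-- The operators `T i` act on vectors indexed by words by interchanging adjacent letters, up to
non-zero scalars; a pair of equal letters `x` is an eigenvector with eigenvalue `Q x`, and on
pairs of distinct letters `T i` is an involution. -/
structure IsSwapAction (b : (Fin n → X) → M) (T : ℕ → Module.End 𝕜 M) (Q : X → 𝕜) : Prop where
  exists_smul : ∀ (y : Fin n → X) (i : ℕ) (h : i + 1 < n), ∃ α : 𝕜, α ≠ 0 ∧
    T i (b y) = α • b (y ∘ Equiv.swap ⟨i, i.lt_succ_self.trans h⟩ ⟨i + 1, h⟩)
  of_eq : ∀ (y : Fin n → X) (i : ℕ) (h : i + 1 < n),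
    y ⟨i, i.lt_succ_self.trans h⟩ = y ⟨i + 1, h⟩ →
      T i (b y) = Q (y ⟨i + 1, h⟩) • b y
  of_ne : ∀ (y : Fin n → X) (i : ℕ) (h : i + 1 < n),
    y ⟨i, i.lt_succ_self.trans h⟩ ≠ y ⟨i + 1, h⟩ → T i (T i (b y)) = b y

theorem comp_swap_of_eq {ι : Type*} [DecidableEq ι] (y : ι → X) {i j : ι} (h : y i = y j) :
    y ∘ Equiv.swap i j = y := by
  funext k
  rcases eq_or_ne k i with rfl | hi
  · simp [h]
  rcases eq_or_ne k j with rfl | hj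
  · simp [h]
  · simp [Equiv.swap_apply_of_ne_of_ne hi hj]

namespace IsSwapAction

variable {b : Module.Basis (Fin n → X) 𝕜 M} {T : ℕ → Module.End 𝕜 M} {Q : X → 𝕜}

/-- For distinct letters `T i` squares to the identity on `b y`, so right divisibility by `1 + T i`
gives the same image for `b y` and `T i (b y)`. -/
theorem symmSum_comp_swap (hb : IsSwapAction b T Q) (hT : IsBraidFamily T) (y : Fin n → X)
    {i : ℕ} (h : i + 1 < n) : ∃ β : 𝕜,
    symmSum T n (b (y ∘ Equiv.swap ⟨i, i.lt_succ_self.trans h⟩ ⟨i + 1, h⟩)) =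
      β • symmSum T n (b y) := by
  by_cases hy : y ⟨i, i.lt_succ_self.trans h⟩ = y ⟨i + 1, h⟩
  · exact ⟨1, by rw [comp_swap_of_eq y hy, one_smul]⟩
  · obtain ⟨α, hα, hαy⟩ := hb.exists_smul y i h
    obtain ⟨B, hB⟩ := hT.exists_symmSum_eq h
    refine ⟨α⁻¹, ?_⟩
    rw [eq_inv_smul_iff₀ hα, ← map_smul, ← hαy, hB]
    simp [hb.of_ne y i h hy, add_comm]

theorem symmSum_comp_perm (hb : IsSwapAction b T Q) (hT : IsBraidFamily T) (y : Fin n → X)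
    (w : Equiv.Perm (Fin n)) : ∃ β : 𝕜,
    symmSum T n (b (y ∘ w)) = β • symmSum T n (b y) := by
  cases n with
  | zero => exact ⟨1, by rw [one_smul, Subsingleton.elim (y ∘ w) y]⟩
  | succ n =>
    have hw : w ∈ Submonoid.closure
        (Set.range fun i : Fin n => Equiv.swap i.castSucc i.succ) := by
      rw [Equiv.Perm.mclosure_swap_castSucc_succ]
      trivial
    induction hw using Submonoid.closure_induction generalizing y with
    | mem w hw =>
      obtain ⟨i, rfl⟩ := hw
      exact hb.symmSum_comp_swap hT y (i := i) (by omega)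
    | one => exact ⟨1, by rw [one_smul]; rfl⟩
    | mul w₁ w₂ _ _ h₁ h₂ =>
      obtain ⟨β₁, hβ₁⟩ := h₁ y
      obtain ⟨β₂, hβ₂⟩ := h₂ (y ∘ w₁)
      exact ⟨β₂ * β₁, by rw [mul_smul, ← hβ₁, ← hβ₂]; rfl⟩

theorem symmSum_mem_span_of_content_eq (hb : IsSwapAction b T Q) (hT : IsBraidFamily T)
    {y z : Fin n → X} (h : content y = content z) :
    symmSum T n (b y) ∈ Submodule.span 𝕜 {symmSum T n (b z)} := by
  obtain ⟨w, rfl⟩ := exists_perm_of_content_eq h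
  obtain ⟨β, hβ⟩ := hb.symmSum_comp_perm hT z w
  exact Submodule.mem_span_singleton.mpr ⟨β, hβ.symm⟩

/-- Swapping letters preserves the span of the words of a given content. -/
theorem repr_symmSum_of_content_ne (hb : IsSwapAction b T Q) {y z : Fin n → X}
    (h : content z ≠ content y) : b.repr (symmSum T n (b y)) z = 0 := by
  have hmem : symmSum T n (b y) ∈ Submodule.span 𝕜 (b '' {u | content u = content y}) := by
    refine symmSum_mem (fun i hi v hv => ?_) (Submodule.subset_span ⟨y, rfl, rfl⟩)
    have hle : Submodule.span 𝕜 (b '' {u | content u = content y}) ≤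
        (Submodule.span 𝕜 (b '' {u | content u = content y})).comap (T i) := by
      rw [Submodule.span_le]
      rintro _ ⟨u, hu, rfl⟩
      obtain ⟨α, -, hα⟩ := hb.exists_smul u i hi
      rw [SetLike.mem_coe, Submodule.mem_comap, hα]
      exact Submodule.smul_mem _ _ (Submodule.subset_span
        ⟨_, (content_comp_perm _ _).trans hu, rfl⟩)
    exact hle hv
  rw [Module.Basis.mem_span_image] at hmem
  by_contra hne
  exact h (hmem (Finsupp.mem_support_iff.mpr hne))

/-- On an initial run of `x` every `T i` is multiplication by `Q x`, so the shuffle sum becomes a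
quantum integer. -/
theorem shuffleSum_of_const (hb : IsSwapAction b T Q) {y : Fin n → X} {x : X} {N : ℕ}
    (hN : N ≤ n) (hy : ∀ i : Fin n, (i : ℕ) < N → y i = x) {k : ℕ} (hk : k < N) :
    shuffleSum T k (b y) = (∑ i ∈ Finset.range (k + 1), Q x ^ i) • b y := by
  induction k with
  | zero => simp [shuffleSum]
  | succ k ih =>
    have hT : T k (b y) = Q x • b y := by
      have h1 := hy ⟨k + 1, by omega⟩ hk
      rw [hb.of_eq y k (by omega) ((hy _ (by simp only; omega)).trans h1.symm), h1]
    rw [shuffleSum, LinearMap.add_apply, Module.End.mul_apply, hT, map_smul, ih (by omega),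
      Module.End.one_apply, geom_sum_succ (n := k + 1), add_smul, mul_smul, one_smul, add_comm]

theorem symmSum_of_const (hb : IsSwapAction b T Q) {y : Fin n → X} {x : X} {N : ℕ}
    (hN : N ≤ n) (hy : ∀ i : Fin n, (i : ℕ) < N → y i = x) {k : ℕ} (hk : k ≤ N) :
    ∃ β : 𝕜, symmSum T k (b y) = β • b y := by
  induction k with
  | zero => exact ⟨1, by simp [symmSum]⟩
  | succ k ih =>
    obtain ⟨β, hβ⟩ := ih (by omega)
    exact ⟨_, by rw [symmSum, Module.End.mul_apply, hβ, map_smul,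
      hb.shuffleSum_of_const hN hy (by omega), smul_smul]⟩

/-- With `N` copies of `x` moved to the front, stage `N` of the symmetrizer contributes `[N]_q = 0`,
and later stages only multiply on the left. -/
theorem symmSum_eq_zero (hb : IsSwapAction b T Q) (hT : IsBraidFamily T) {y : Fin n → X} {x : X}
    {N : ℕ} (hN : 1 < N) (hQ : IsPrimitiveRoot (Q x) N) (hy : N ≤ content y x) :
    symmSum T n (b y) = 0 := by
  obtain ⟨w, hw⟩ := exists_perm_of_le_content y x hy
  have hNn : N ≤ n := hy.trans <| by
    simpa [content] using Nat.card_le_card_of_injective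
      (Subtype.val : {i // y i = x} → Fin n) Subtype.val_injective
  have key : ∀ m, N ≤ m → symmSum T m (b (y ∘ w)) = 0 := by
    intro m hm
    induction m, hm using Nat.le_induction with
    | base =>
      obtain ⟨k, rfl⟩ := Nat.exists_eq_succ_of_ne_zero (by omega : N ≠ 0)
      obtain ⟨β, hβ⟩ := hb.symmSum_of_const hNn hw k.le_succ
      rw [symmSum, Module.End.mul_apply, hβ, map_smul, hb.shuffleSum_of_const hNn hw
        k.lt_succ_self, hQ.geom_sum_eq_zero hN, zero_smul, smul_zero]
    | succ m _ ih => rw [symmSum, Module.End.mul_apply, ih, map_zero]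
  obtain ⟨β, hβ⟩ := hb.symmSum_comp_perm hT (y ∘ w) w⁻¹
  have : (y ∘ w) ∘ (w⁻¹ : Equiv.Perm (Fin n)) = y := by funext i; simp
  rw [this] at hβ
  rw [hβ, key n hNn, smul_zero]

-- A summand moves the letter at position `k` left to some position `j`. If this yields the grouped
-- word `y`, then `y` is constant from `j` to `m`, so only equal letters were passed and `z = y`;
-- each such `j` contributes `Q (y m) ^ (k - j)`. Keeping `m` separate from `k` lets the induction
-- follow the travelling letter.
open Classical in
theorem repr_shuffleSum (hb : IsSwapAction b T Q) {y : Fin n → X} (hy : IsGrouped y)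
    (m : Fin n) {k : ℕ} (hk : k ≤ m) (z : Fin n → X) (hz : z ⟨k, hk.trans_lt m.2⟩ = y m) :
    b.repr (shuffleSum T k (b z)) y = if z = y then
      ∑ i ∈ Finset.range (Nat.count (fun j => ∃ h : j < n, y ⟨j, h⟩ = y m) (k + 1)), Q (y m) ^ i
      else 0 := by
  have hrepr : ∀ u : Fin n → X, b.repr (b u) y = if u = y then 1 else 0 := by
    intro u
    rw [Module.Basis.repr_self, Finsupp.single_apply]
  induction k generalizing z with
  | zero =>
    rw [shuffleSum, Module.End.one_apply, hrepr]
    refine if_ctx_congr Iff.rfl (fun h => ?_) fun _ => rfl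
    have h0 : ∃ h : 0 < n, y ⟨0, h⟩ = y m := ⟨_, h ▸ hz⟩
    simp [Nat.count_succ, h0]
  | succ k ih =>
    have hk1 : k + 1 < n := hk.trans_lt m.2
    set s : Equiv.Perm (Fin n) := Equiv.swap ⟨k, k.lt_succ_self.trans hk1⟩ ⟨k + 1, hk1⟩ with hs
    have hzs : (z ∘ s) ⟨k, k.lt_succ_self.trans hk1⟩ = y m := by
      simpa [hs] using hz
    have hstep : shuffleSum T (k + 1) (b z) = b z + shuffleSum T k (T k (b z)) := rfl
    have ih' := ih (by omega) (z ∘ s) hzs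
    by_cases hyk : y ⟨k, k.lt_succ_self.trans hk1⟩ = y m
    · have hyk1 : y ⟨k + 1, hk1⟩ = y m := by
        rw [← hyk]
        exact hy _ _ m (Fin.mk_le_mk.mpr k.le_succ) hk hyk
      by_cases hzy : z = y
      · subst hzy
        have hzs' : z ∘ s = z := comp_swap_of_eq z (hyk.trans hyk1.symm)
        rw [hzs', if_pos rfl] at ih'
        rw [hstep, hb.of_eq z k hk1 (hyk.trans hyk1.symm), hyk1, map_smul, map_add, map_smul,
          Finsupp.add_apply, Finsupp.smul_apply, ih', hrepr, if_pos rfl, if_pos rfl,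
          Nat.count_succ _ (k + 1), if_pos ⟨hk1, hyk1⟩, geom_sum_succ, smul_eq_mul, add_comm]
      · have hzs' : z ∘ s ≠ y := by
          intro h
          apply hzy
          have : z = y ∘ s := by rw [← h]; funext i; simp [hs]
          rw [this]
          exact comp_swap_of_eq y (hyk.trans hyk1.symm)
        obtain ⟨α, -, hα⟩ := hb.exists_smul z k hk1
        rw [hstep, hα, map_smul, map_add, map_smul, Finsupp.add_apply, Finsupp.smul_apply,
          ih', if_neg hzs', if_neg hzy, hrepr, if_neg hzy, smul_zero, add_zero]
    · have hzs' : z ∘ s ≠ y := by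
        intro h
        exact hyk (h ▸ hzs)
      obtain ⟨α, -, hα⟩ := hb.exists_smul z k hk1
      rw [hstep, hα, map_smul, map_add, map_smul, Finsupp.add_apply, Finsupp.smul_apply,
        ih', if_neg hzs', hrepr, smul_zero, add_zero]
      refine if_ctx_congr Iff.rfl (fun h => ?_) fun _ => rfl
      -- An earlier occurrence of `y m` would, by grouping, force `y` to take that value at `k` too;
      -- hence only the unmoved summand counts.
      have h0 : Nat.count (fun j => ∃ h : j < n, y ⟨j, h⟩ = y m) (k + 1) = 0 := by
        rw [Nat.count_iff_forall_not]
        rintro j hj ⟨hjn, hj'⟩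
        apply hyk
        rw [← hj']
        exact hy _ _ m (Fin.mk_le_mk.mpr (by omega)) (Fin.le_def.mpr (by simp only; omega)) hj'
      rw [Nat.count_succ, h0, if_pos ⟨hk1, h ▸ hz⟩]
      simp

/-- `symmSum T k` involves only swaps of the first `k` positions, so the letter at position `k`
stays put. -/
theorem symmSum_mem_span_agree (hb : IsSwapAction b T Q) (y : Fin n → X) {k : ℕ} (hk : k < n) :
    symmSum T k (b y) ∈ Submodule.span 𝕜 (b '' {z | z ⟨k, hk⟩ = y ⟨k, hk⟩}) := by
  refine symmSum_mem (fun i hi v hv => ?_) (Submodule.subset_span ⟨y, rfl, rfl⟩)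
  have hle : Submodule.span 𝕜 (b '' {z | z ⟨k, hk⟩ = y ⟨k, hk⟩}) ≤
      (Submodule.span 𝕜 (b '' {z | z ⟨k, hk⟩ = y ⟨k, hk⟩})).comap (T i) := by
    rw [Submodule.span_le]
    rintro _ ⟨u, hu, rfl⟩
    obtain ⟨α, -, hα⟩ := hb.exists_smul u i (by omega)
    rw [SetLike.mem_coe, Submodule.mem_comap, hα]
    refine Submodule.smul_mem _ _ (Submodule.subset_span ⟨_, ?_, rfl⟩)
    rw [Set.mem_ofPred_eq, Function.comp_apply, Equiv.swap_apply_of_ne_of_ne]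
    · exact hu
    · exact fun h => by simp only [Fin.mk.injEq] at h; omega
    · exact fun h => by simp only [Fin.mk.injEq] at h; omega
  exact hle hv

open Classical in
theorem repr_symmSum_succ (hb : IsSwapAction b T Q) {y : Fin n → X} (hy : IsGrouped y)
    {k : ℕ} (hk : k < n) :
    b.repr (symmSum T (k + 1) (b y)) y =
      (∑ i ∈ Finset.range
        (Nat.count (fun j => ∃ h : j < n, y ⟨j, h⟩ = y ⟨k, hk⟩) (k + 1)), Q (y ⟨k, hk⟩) ^ i) *
      b.repr (symmSum T k (b y)) y := by
  rw [symmSum, Module.End.mul_apply]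
  have hv := hb.symmSum_mem_span_agree y hk
  generalize symmSum T k (b y) = v at hv
  induction hv using Submodule.span_induction with
  | zero => simp
  | add u v _ _ hu hv => simp only [map_add, Finsupp.add_apply, hu, hv, mul_add]
  | smul a u _ hu =>
    simp only [map_smul, Finsupp.smul_apply, hu, smul_eq_mul]
    ring
  | mem u hu =>
    obtain ⟨z, hz, rfl⟩ := hu
    rw [hb.repr_shuffleSum hy ⟨k, hk⟩ le_rfl z hz, Module.Basis.repr_self, Finsupp.single_apply]
    split_ifs <;> simp

theorem repr_symmSum_ne_zero (hb : IsSwapAction b T Q) {y : Fin n → X} (hy : IsGrouped y)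
    (hQ : ∀ x p, 0 < p → p ≤ content y x → ∑ i ∈ Finset.range p, Q x ^ i ≠ 0) :
    b.repr (symmSum T n (b y)) y ≠ 0 := by
  classical
  have key : ∀ k ≤ n, b.repr (symmSum T k (b y)) y ≠ 0 := by
    intro k hk
    induction k with
    | zero => simp [symmSum]
    | succ k ih =>
      rw [hb.repr_symmSum_succ hy (by omega)]
      refine mul_ne_zero (hQ _ _ ?_ (count_le_content y _ _)) (ih (by omega))
      rw [Nat.count_succ, if_pos ⟨by omega, rfl⟩]
      omega
  exact key n le_rfl

end IsSwapAction

end SwapAction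

end Nichols

namespace SetYB

/-! ### Fixed pairs of an involutive solution -/

section Solution

variable {X : Type*} {r : X × X → X × X}

theorem IsInvolutive.sigma_sigma_tau (hinv : IsInvolutive r) (i j : X) :
    sigma r (sigma r i j) (tau r j i) = i := congrArg Prod.fst (hinv (i, j))

theorem IsInvolutive.tau_tau_sigma (hinv : IsInvolutive r) (i j : X) :
    tau r (tau r j i) (sigma r i j) = j := congrArg Prod.snd (hinv (i, j))

theorem IsSolution.sigma_sigma (hr : IsSolution r) (i j k : X) :
    sigma r (sigma r i j) (sigma r (tau r j i) k) = sigma r i (sigma r j k) := by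
  have h := congrArg Prod.fst (hr.yang_baxter (i, j, k))
  exact h

theorem IsSolution.tau_sigma (hr : IsSolution r) (i j k : X) :
    tau r (sigma r (tau r j i) k) (sigma r i j) =
      sigma r (tau r (sigma r j k) i) (tau r k j) := by
  have h := congrArg (fun p => p.2.1) (hr.yang_baxter (i, j, k))
  exact h

theorem IsSolution.tau_tau (hr : IsSolution r) (i j k : X) :
    tau r k (tau r j i) = tau r (tau r k j) (tau r (sigma r j k) i) := by
  have h := congrArg (fun p => p.2.2) (hr.yang_baxter (i, j, k))
  exact h

theorem tau_diagonal (hnd : IsNonDegenerate r) (j : X) : tau r j (diagonal hnd j) = j :=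
  Equiv.ofBijective_apply_symm_apply (tau r j) (hnd.tau_bijective j) j

/-- For involutive `r`, injectivity of `σ_i` and `τ_j` makes either of `σ_i(j) = i` and `τ_j(i) = j`
imply the other; both say that `(i, j)` is fixed by `r`. -/
theorem sigma_eq_self_iff (hnd : IsNonDegenerate r) (hinv : IsInvolutive r) {i j : X} :
    sigma r i j = i ↔ i = diagonal hnd j := by
  constructor
  · intro h
    apply (hnd.tau_bijective j).1
    rw [tau_diagonal]
    apply (hnd.sigma_bijective i).1
    have := hinv.sigma_sigma_tau i j
    rw [h] at this ⊢
    exact this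
  · intro h
    have ht : tau r j i = j := h ▸ tau_diagonal hnd j
    have := hinv.tau_tau_sigma i j
    rw [ht] at this
    exact (hnd.tau_bijective j).1 (this.trans ht.symm)

/-- The permutation `σ_i`. -/
noncomputable def sigmaPerm (hnd : IsNonDegenerate r) (i : X) : Equiv.Perm X :=
  Equiv.ofBijective (sigma r i) (hnd.sigma_bijective i)

theorem sigmaPerm_apply (hnd : IsNonDegenerate r) (i j : X) :
    sigmaPerm hnd i j = sigma r i j := rfl

variable {𝕜 : Type*} [Field 𝕜] {R : X → X → 𝕜}

/-- The scalar `R_{D(i), i}` does not change when `i` is moved by some `σ_k`. -/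
theorem IsBraidingCoeff.diagonal_sigma (hR : IsBraidingCoeff r R) (hr : IsSolution r)
    (hnd : IsNonDegenerate r) (hinv : IsInvolutive r) (k j : X) :
    R (diagonal hnd (sigma r k j)) (sigma r k j) = R (diagonal hnd j) j := by
  set a := diagonal hnd j with ha
  -- Writing `k = τ_a(l)` allows the coefficient identity at `(l, a, j)`; since `(a, j)` is fixed by
  -- `r`, two factors on each side coincide and cancel.
  obtain ⟨l, rfl⟩ := (hnd.tau_bijective a).2 k
  have hs : sigma r a j = a := (sigma_eq_self_iff hnd hinv).mpr ha
  have ht : tau r j a = j := tau_diagonal hnd j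
  have hfix : sigma r l a = diagonal hnd (sigma r (tau r a l) j) := by
    rw [← sigma_eq_self_iff hnd hinv, hr.sigma_sigma, hs]
  have hb := hR.braid l a j
  rw [hs, ht] at hb
  rw [← hfix]
  refine mul_left_cancel₀ (mul_ne_zero (hR.ne_zero l a) (hR.ne_zero (tau r a l) j)) ?_
  linear_combination hb

end Solution

/-! ### Guitar coordinates on words -/

section Guitar

variable {X : Type*}

/-- The permutation `σ_{x_1} ⋯ σ_{x_n}` attached to the word `x_1 ⋯ x_n` whose guitar coordinates
are `y`. -/
def prefixPerm (s : X → Equiv.Perm X) : (n : ℕ) → (Fin n → X) → Equiv.Perm X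
  | 0, _ => 1
  | n + 1, y => prefixPerm s n (Fin.init y) *
      s ((prefixPerm s n (Fin.init y))⁻¹ (y (Fin.last n)))

/-- Appending a letter, in guitar coordinates. -/
def guitarSnoc (s : X → Equiv.Perm X) (n : ℕ) : (Fin n → X) × X ≃ (Fin (n + 1) → X) where
  toFun p := Fin.snoc p.1 (prefixPerm s n p.1 p.2)
  invFun y := (Fin.init y, (prefixPerm s n (Fin.init y))⁻¹ (y (Fin.last n)))
  left_inv p := by simp
  right_inv y := by simp

variable {𝕜 V : Type*} [Field 𝕜] [AddCommGroup V] [Module 𝕜 V] (e : Module.Basis X 𝕜 V)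

/-- The basis of words of `V^{⊗n}`, indexed by guitar coordinates: the word `x_1 ⋯ x_n` has
coordinates `y_k = σ_{x_1} ⋯ σ_{x_{k-1}} (x_k)`. -/
noncomputable def guitarBasis (s : X → Equiv.Perm X) :
    (n : ℕ) → Module.Basis (Fin n → X) 𝕜 (⨂[𝕜]^n V)
  | 0 => (Module.Basis.singleton (Fin 0 → X) 𝕜).map (PiTensorProduct.isEmptyEquiv (Fin 0)).symm
  | n + 1 => (((guitarBasis s n).tensorProduct e).map
      (Nichols.snocEquiv 𝕜 V n)).reindex (guitarSnoc s n)

theorem guitarBasis_succ (s : X → Equiv.Perm X) (n : ℕ) (y : Fin (n + 1) → X) :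
    guitarBasis e s (n + 1) y = Nichols.snocEquiv 𝕜 V n
      (guitarBasis e s n (Fin.init y) ⊗ₜ
        e ((prefixPerm s n (Fin.init y))⁻¹ (y (Fin.last n)))) := by
  rw [guitarBasis, Module.Basis.reindex_apply, Module.Basis.map_apply]
  change Nichols.snocEquiv 𝕜 V n
    (((guitarBasis e s n).tensorProduct e) (_, _)) = _
  rw [Module.Basis.tensorProduct_apply, ]

theorem guitarBasis_succ_succ (s : X → Equiv.Perm X) (n : ℕ) (y : Fin (n + 2) → X) :
    guitarBasis e s (n + 2) y = Nichols.snocTwo (guitarBasis e s n (Fin.init (Fin.init y)))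
      (e ((prefixPerm s n (Fin.init (Fin.init y)))⁻¹ (Fin.init y (Fin.last n))) ⊗ₜ
        e ((s ((prefixPerm s n (Fin.init (Fin.init y)))⁻¹ (Fin.init y (Fin.last n))))⁻¹
          ((prefixPerm s n (Fin.init (Fin.init y)))⁻¹ (y (Fin.last (n + 1)))))) := by
  rw [Nichols.snocTwo_tmul, guitarBasis_succ, guitarBasis_succ, prefixPerm, mul_inv_rev,
    Equiv.Perm.mul_apply]

theorem init_comp_swap {n i : ℕ} (y : Fin (n + 1) → X) (h : i + 1 < n) :
    Fin.init (y ∘ Equiv.swap ⟨i, by omega⟩ ⟨i + 1, by omega⟩) =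
      Fin.init y ∘ Equiv.swap ⟨i, by omega⟩ ⟨i + 1, h⟩ := by
  funext k
  simp only [Fin.init, Function.comp_apply, Equiv.swap_apply_def, Fin.ext_iff, Fin.val_castSucc]
  split_ifs <;> rfl

theorem comp_swap_last {n i : ℕ} (y : Fin (n + 1) → X) (h : i + 1 < n) :
    (y ∘ Equiv.swap ⟨i, by omega⟩ ⟨i + 1, by omega⟩) (Fin.last n) = y (Fin.last n) := by
  rw [Function.comp_apply, Equiv.swap_apply_of_ne_of_ne]
  · exact fun h => by simp only [Fin.ext_iff, Fin.val_last] at h; omega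
  · exact fun h => by simp only [Fin.ext_iff, Fin.val_last] at h; omega

end Guitar

/-! ### The braiding in guitar coordinates -/

section Braiding

variable {X : Type*} {r : X × X → X × X} {𝕜 V : Type*} [Field 𝕜] [AddCommGroup V] [Module 𝕜 V]
  {R : X → X → 𝕜} {e : Module.Basis X 𝕜 V} {c : Module.End 𝕜 (V ⊗[𝕜] V)}

theorem braiding_single (i j : X) :
    braiding r R (Finsupp.single i 1 ⊗ₜ Finsupp.single j 1) =
      R i j • (Finsupp.single (sigma r i j) 1 ⊗ₜ Finsupp.single (tau r j i) 1) := by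
  simp [braiding]

theorem lastBraid_basis
    (hc : ∀ i j, c (e i ⊗ₜ e j) = R i j • (e (sigma r i j) ⊗ₜ[𝕜] e (tau r j i)))
    {n : ℕ} (u : ⨂[𝕜]^n V) (i j : X) :
    Nichols.lastBraid c n (Nichols.snocTwo u (e i ⊗ₜ e j)) =
      R i j • Nichols.snocTwo u (e (sigma r i j) ⊗ₜ e (tau r j i)) := by
  rw [Nichols.lastBraid_snocTwo, hc, map_smul]

theorem IsBraidingCoeff.isBraidFamily (hR : IsBraidingCoeff r R) (hr : IsSolution r)
    (hc : ∀ i j, c (e i ⊗ₜ e j) = R i j • (e (sigma r i j) ⊗ₜ[𝕜] e (tau r j i)))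
    (n : ℕ) : Nichols.IsBraidFamily (Nichols.strand c n) := by
  refine Nichols.isBraidFamily_strand _ (fun n => ?_) n
  -- With trivial permutations the coordinates are the letters themselves, so this is the ordinary
  -- tensor basis.
  refine (guitarBasis e (fun _ : X => 1) (n + 3)).ext fun y => ?_
  obtain ⟨u, z₁, z₂, z₃, hy⟩ : ∃ (u : ⨂[𝕜]^n V) (z₁ z₂ z₃ : X),
      guitarBasis e (fun _ : X => 1) (n + 3) y = Nichols.snocEquiv 𝕜 V (n + 2)
        (Nichols.snocTwo u (e z₁ ⊗ₜ e z₂) ⊗ₜ e z₃) :=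
    ⟨_, _, _, _, by rw [guitarBasis_succ, guitarBasis_succ_succ]⟩
  rw [hy]
  have hE : ∀ i j k : X, Nichols.extendHom 𝕜 V (n + 2)
        (Nichols.lastBraid c n) (Nichols.snocEquiv 𝕜 V (n + 2)
          (Nichols.snocTwo u (e i ⊗ₜ e j) ⊗ₜ
            e k)) =
      R i j • Nichols.snocEquiv 𝕜 V (n + 2)
          (Nichols.snocTwo u (e (sigma r i j) ⊗ₜ e (tau r j i)) ⊗ₜ
            e k) := by
    intro i j k
    rw [Nichols.extendHom_snoc, lastBraid_basis hc, ← TensorProduct.smul_tmul', map_smul]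
  have hL : ∀ i j k : X, Nichols.lastBraid c (n + 1)
        (Nichols.snocEquiv 𝕜 V (n + 2)
          (Nichols.snocTwo u (e i ⊗ₜ e j) ⊗ₜ
            e k)) =
      R j k • Nichols.snocEquiv 𝕜 V (n + 2)
          (Nichols.snocTwo u (e i ⊗ₜ e (sigma r j k)) ⊗ₜ
            e (tau r k j)) := by
    intro i j k
    rw [Nichols.snocTwo_tmul, ← Nichols.snocTwo_tmul, lastBraid_basis hc, Nichols.snocTwo_tmul,
      Nichols.snocTwo_tmul]
  simp only [Module.End.mul_apply, hE, hL, map_smul, smul_smul]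
  rw [hr.sigma_sigma, hr.tau_sigma, ← hr.tau_tau]
  congr 1
  linear_combination hR.braid z₁ z₂ z₃

/-- With prefix `g` and neighbours `a, b`, the coordinates are `g a` and `g σ_a(b)`; after applying
`r` they are `g σ_a(b)` and `g a`, because `r² = id`. The identity `σ_a σ_b = σ_{σ_a(b)} σ_{τ_b(a)}`
keeps the prefix permutation unchanged. That invariance belongs to the induction because later
letters are decoded through it. -/
theorem strand_guitarBasis (hr : IsSolution r) (hnd : IsNonDegenerate r)
    (hinv : IsInvolutive r) (hR : IsBraidingCoeff r R)
    (hc : ∀ i j, c (e i ⊗ₜ e j) = R i j • (e (sigma r i j) ⊗ₜ[𝕜] e (tau r j i)))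
    (hRR : ∀ i j, i ≠ diagonal hnd j → R i j * R (sigma r i j) (tau r j i) = 1)
    {n i : ℕ} (y : Fin n → X) (h : i + 1 < n) :
    prefixPerm (sigmaPerm hnd) n
        (y ∘ Equiv.swap ⟨i, i.lt_succ_self.trans h⟩ ⟨i + 1, h⟩) =
      prefixPerm (sigmaPerm hnd) n y ∧
    ∃ α : 𝕜, α ≠ 0 ∧
      Nichols.strand c n i (guitarBasis e (sigmaPerm hnd) n y) =
        α • guitarBasis e (sigmaPerm hnd) n
          (y ∘ Equiv.swap ⟨i, i.lt_succ_self.trans h⟩ ⟨i + 1, h⟩) ∧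
      (y ⟨i, i.lt_succ_self.trans h⟩ = y ⟨i + 1, h⟩ →
        α = R (diagonal hnd (y ⟨i + 1, h⟩)) (y ⟨i + 1, h⟩)) ∧
      (y ⟨i, i.lt_succ_self.trans h⟩ ≠ y ⟨i + 1, h⟩ →
        Nichols.strand c n i (guitarBasis e (sigmaPerm hnd) n
          (y ∘ Equiv.swap ⟨i, i.lt_succ_self.trans h⟩ ⟨i + 1, h⟩)) =
            α⁻¹ • guitarBasis e (sigmaPerm hnd) n y) := by
  induction n with
  | zero => omega
  | succ n ih =>
    rcases Nat.lt_or_ge (i + 1) n with hi | hi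
    · obtain ⟨hp, α, hα, h1, h2, h3⟩ := ih (Fin.init y) hi
      have hp' := init_comp_swap y hi
      have hl := comp_swap_last y hi
      refine ⟨?_, α, hα, ?_, h2, fun hne => ?_⟩
      · rw [prefixPerm, prefixPerm, hp', hl, hp]
      · rw [Nichols.strand_succ _ (by omega), guitarBasis_succ, guitarBasis_succ,
          Nichols.extendHom_snoc, h1, hp', hl, hp, ← TensorProduct.smul_tmul', map_smul]
      · rw [Nichols.strand_succ _ (by omega), guitarBasis_succ, guitarBasis_succ, hp', hl, hp,
          Nichols.extendHom_snoc, h3 hne, ← TensorProduct.smul_tmul', map_smul]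
    · obtain rfl : n = i + 1 := by omega
      set s := sigmaPerm hnd with hs
      set y' := y ∘ Equiv.swap ⟨i, i.lt_succ_self.trans h⟩ ⟨i + 1, h⟩ with hy'
      set z₁ := y ⟨i, i.lt_succ_self.trans h⟩ with hz₁
      set z₂ := y ⟨i + 1, h⟩ with hz₂
      have hu : Fin.init (Fin.init y') = Fin.init (Fin.init y) := by
        funext k
        simp only [Fin.init, hy', Function.comp_apply]
        rw [Equiv.swap_apply_of_ne_of_ne] <;>
          exact fun h => by simp only [Fin.ext_iff, Fin.val_castSucc] at h; omega
      have hy1 : Fin.init y (Fin.last i) = z₁ := rfl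
      have hy2 : y (Fin.last (i + 1)) = z₂ := rfl
      have hy1' : Fin.init y' (Fin.last i) = z₂ :=
        congrArg y (Equiv.swap_apply_left (⟨i, _⟩ : Fin (i + 2)) ⟨i + 1, _⟩)
      have hy2' : y' (Fin.last (i + 1)) = z₁ :=
        congrArg y (Equiv.swap_apply_right (⟨i, _⟩ : Fin (i + 2)) ⟨i + 1, _⟩)
      set g := prefixPerm s i (Fin.init (Fin.init y)) with hg
      set a := g⁻¹ z₁ with ha
      set b := (s a)⁻¹ (g⁻¹ z₂) with hb
      have hab : sigma r a b = g⁻¹ z₂ := by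
        rw [← sigmaPerm_apply hnd, ← hs, hb, ← Equiv.Perm.mul_apply, mul_inv_cancel, Equiv.Perm.one_apply]
      have hba : tau r b a = (s (g⁻¹ z₂))⁻¹ a := by
        rw [Equiv.Perm.eq_inv_iff_eq, ← hab, hs, sigmaPerm_apply, hinv.sigma_sigma_tau]
      have hE : guitarBasis e s (i + 2) y = Nichols.snocTwo
          (guitarBasis e s i (Fin.init (Fin.init y)))
          (e a ⊗ₜ e b) := by
        rw [guitarBasis_succ_succ, hy1, hy2]
      have hE' : guitarBasis e s (i + 2) y' = Nichols.snocTwo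
          (guitarBasis e s i (Fin.init (Fin.init y)))
          (e (sigma r a b) ⊗ₜ e (tau r b a)) := by
        rw [guitarBasis_succ_succ, hu, hy1', hy2', hab, hba]
      have hfix : a = diagonal hnd b ↔ z₁ = z₂ := by
        rw [← sigma_eq_self_iff hnd hinv, hab, ha]
        exact ⟨fun h => (g⁻¹.injective h).symm, fun h => by rw [h]⟩
      -- The eigenvalue arises at the letter `b`, while the statement evaluates it at a coordinate;
      -- the two differ by a product of `σ`'s.
      have hinvariant : ∀ (m : ℕ) (w : Fin m → X) (x : X),
          R (diagonal hnd (prefixPerm s m w x)) (prefixPerm s m w x) =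
            R (diagonal hnd x) x := by
        intro m
        induction m with
        | zero => intro w x; rfl
        | succ m ihm =>
          intro w x
          rw [prefixPerm, Equiv.Perm.mul_apply, ihm]
          exact hR.diagonal_sigma hr hnd hinv _ _
      refine ⟨?_, R a b, hR.ne_zero a b, ?_, fun heq => ?_, fun hne => ?_⟩
      · have hp : ∀ w : Fin (i + 2) → X, prefixPerm s (i + 2) w =
            prefixPerm s i (Fin.init (Fin.init w)) *
              (s ((prefixPerm s i (Fin.init (Fin.init w)))⁻¹ (Fin.init w (Fin.last i))) *
              s ((s ((prefixPerm s i (Fin.init (Fin.init w)))⁻¹ (Fin.init w (Fin.last i))))⁻¹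
                ((prefixPerm s i (Fin.init (Fin.init w)))⁻¹ (w (Fin.last (i + 1)))))) := by
          intro w
          rw [prefixPerm, prefixPerm, mul_inv_rev, Equiv.Perm.mul_apply, mul_assoc]
        rw [hp, hp, hu, hy1', hy2', hy1, hy2, ← hg, ← ha, ← hb, ← hba, ← hab]
        congr 1
        ext k
        exact hr.sigma_sigma a b k
      · rw [Nichols.strand_last, hE, hE', lastBraid_basis hc]
      · have h1 : sigma r a b = a := (sigma_eq_self_iff hnd hinv).mpr (hfix.mpr heq)
        have h2 : z₂ = prefixPerm s i (Fin.init (Fin.init y)) (sigma r a b) := by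
          rw [hab, ← hg, ← Equiv.Perm.mul_apply, mul_inv_cancel, Equiv.Perm.one_apply]
        rw [h2, hinvariant, hR.diagonal_sigma hr hnd hinv, ← hfix.mpr heq]
      · rw [Nichols.strand_last, hE, hE', lastBraid_basis hc, hinv.sigma_sigma_tau,
          hinv.tau_tau_sigma, eq_inv_of_mul_eq_one_right (hRR a b fun h => hne (hfix.mp h))]

theorem isSwapAction_strand (hr : IsSolution r) (hnd : IsNonDegenerate r)
    (hinv : IsInvolutive r) (hR : IsBraidingCoeff r R)
    (hc : ∀ i j, c (e i ⊗ₜ e j) = R i j • (e (sigma r i j) ⊗ₜ[𝕜] e (tau r j i)))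
    (hRR : ∀ i j, i ≠ diagonal hnd j → R i j * R (sigma r i j) (tau r j i) = 1) (n : ℕ) :
    Nichols.IsSwapAction (guitarBasis e (sigmaPerm hnd) n)
      (Nichols.strand c n) (fun i => R (diagonal hnd i) i) where
  exists_smul y i h := by
    obtain ⟨-, α, hα, h1, -, -⟩ := strand_guitarBasis hr hnd hinv hR hc hRR y h
    exact ⟨α, hα, h1⟩
  of_eq y i h heq := by
    obtain ⟨-, α, -, h1, h2, -⟩ := strand_guitarBasis hr hnd hinv hR hc hRR y h
    rw [h1, h2 heq, Nichols.comp_swap_of_eq y heq]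
  of_ne y i h hne := by
    obtain ⟨-, α, hα, h1, -, h3⟩ := strand_guitarBasis hr hnd hinv hR hc hRR y h
    rw [h1, map_smul, h3 hne, smul_inv_smul₀ hα]

end Braiding

end SetYB

namespace Nichols

/-! ### Counting contents to find the dimension -/

section Dimension

variable {𝕜 V X : Type*} [Field 𝕜] [AddCommGroup V] [Module 𝕜 V]

/-- The image under the quantum symmetrizers of the basis vector of the tensor algebra that is
indexed by the word `p`. -/
noncomputable def symmetrizedWord (c : Module.End 𝕜 (V ⊗[𝕜] V))
    (b : ∀ n, Module.Basis (Fin n → X) 𝕜 (⨂[𝕜]^n V)) (p : Σ n, Fin n → X) :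
    ⨁ n, ⨂[𝕜]^n V :=
  DirectSum.lof 𝕜 ℕ (fun n => ⨂[𝕜]^n V) p.1 (symmetrizer c p.1 (b p.1 p.2))

/-- The coordinate of a vector of `⨁ₙ V^{⊗n}` at the word `p`. -/
noncomputable def wordCoord (b : ∀ n, Module.Basis (Fin n → X) 𝕜 (⨂[𝕜]^n V))
    (p : Σ n, Fin n → X) : (⨁ n, ⨂[𝕜]^n V) →ₗ[𝕜] 𝕜 :=
  (b p.1).coord p.2 ∘ₗ DirectSum.component 𝕜 ℕ (fun n => ⨂[𝕜]^n V) p.1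

variable {c : Module.End 𝕜 (V ⊗[𝕜] V)} {b : ∀ n, Module.Basis (Fin n → X) 𝕜 (⨂[𝕜]^n V)}
  {Q : X → 𝕜}

theorem wordCoord_self (p : Σ n, Fin n → X) : wordCoord b p (symmetrizedWord c b p) =
    (b p.1).repr (symmSum (strand c p.1) p.1 (b p.1 p.2)) p.2 := by
  rw [wordCoord, symmetrizedWord, LinearMap.comp_apply, DirectSum.component.lof_self,
    symmetrizer_eq, Module.Basis.coord_apply]

theorem wordCoord_of_content_ne (hb : ∀ n, IsSwapAction (b n) (strand c n) Q)
    {p p' : Σ n, Fin n → X} (h : content p.2 ≠ content p'.2) :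
    wordCoord b p (symmetrizedWord c b p') = 0 := by
  obtain ⟨n, y⟩ := p
  obtain ⟨n', y'⟩ := p'
  rcases eq_or_ne n n' with rfl | hn
  · rw [wordCoord, symmetrizedWord, LinearMap.comp_apply, DirectSum.component.lof_self,
      symmetrizer_eq, Module.Basis.coord_apply, (hb n).repr_symmSum_of_content_ne h]
  · rw [wordCoord, symmetrizedWord, LinearMap.comp_apply, DirectSum.component.of,
      dif_neg hn.symm, map_zero]

theorem symmetrizedWord_mem_span [Fintype X] (hT : ∀ n, IsBraidFamily (strand c n))
    (hb : ∀ n, IsSwapAction (b n) (strand c n) Q)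
    {p p' : Σ n, Fin n → X} (h : content p.2 = content p'.2) :
    symmetrizedWord c b p ∈ Submodule.span 𝕜 {symmetrizedWord c b p'} := by
  obtain ⟨n, y⟩ := p
  obtain ⟨n', y'⟩ := p'
  obtain rfl : n = n' := by rw [← sum_content y, ← sum_content y', h]
  obtain ⟨β, hβ⟩ := Submodule.mem_span_singleton.mp
    ((hb n).symmSum_mem_span_of_content_eq (hT n) h)
  refine Submodule.mem_span_singleton.mpr ⟨β, ?_⟩
  simp only [symmetrizedWord, symmetrizer_eq]
  rw [← hβ, map_smul]

theorem range_lmap_symmetrizer (b : ∀ n, Module.Basis (Fin n → X) 𝕜 (⨂[𝕜]^n V)) :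
    LinearMap.range (DirectSum.lmap fun n => symmetrizer c n) =
      Submodule.span 𝕜 (Set.range (symmetrizedWord c b)) := by
  apply le_antisymm
  · rintro _ ⟨x, rfl⟩
    induction x using DirectSum.induction_on with
    | zero => rw [map_zero]; exact Submodule.zero_mem _
    | add x y hx hy => rw [map_add]; exact Submodule.add_mem _ hx hy
    | of n u =>
      change DirectSum.lmap _ (DirectSum.lof 𝕜 ℕ (fun n => ⨂[𝕜]^n V) n u) ∈ _
      rw [DirectSum.lmap_lof]
      induction (b n).mem_span u using Submodule.span_induction with
      | zero => rw [map_zero, map_zero]; exact Submodule.zero_mem _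
      | add x y _ _ hx hy => rw [map_add, map_add]; exact Submodule.add_mem _ hx hy
      | smul a x _ hx => rw [map_smul, map_smul]; exact Submodule.smul_mem _ _ hx
      | mem x hx =>
        obtain ⟨y, rfl⟩ := hx
        exact Submodule.subset_span ⟨⟨n, y⟩, rfl⟩
  · rw [Submodule.span_le]
    rintro _ ⟨p, rfl⟩
    exact ⟨DirectSum.lof 𝕜 ℕ (fun n => ⨂[𝕜]^n V) p.1 (b p.1 p.2), DirectSum.lmap_lof _ _ _⟩

/-- If the braid group acts on the tensor powers as it does for a quantum linear space, up to
scalars, then the Nichols algebra has the dimension of a quantum linear space. -/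
theorem finrank_nicholsAlgebra [Fintype X] (hT : ∀ n, IsBraidFamily (strand c n))
    (hb : ∀ n, IsSwapAction (b n) (strand c n) Q) {N : X → ℕ} (hN : ∀ x, 1 < N x)
    (hQ : ∀ x, IsPrimitiveRoot (Q x) (N x)) :
    FiniteDimensional 𝕜 (NicholsAlgebra c) ∧
      Module.finrank 𝕜 (NicholsAlgebra c) = ∏ x, N x := by
  classical
  -- One grouped representative for each content with all multiplicities below `N x`; these will
  -- index a basis of the image.
  choose p hpg hpc using fun μ : ∀ x, Fin (N x) =>
    exists_isGrouped_content_eq (fun x => (μ x : ℕ))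
  have hgeom : ∀ x k, 0 < k → k < N x → ∑ i ∈ Finset.range k, Q x ^ i ≠ 0 := by
    intro x k hk hkN h0
    have h1 := geom_sum_mul (Q x) k
    rw [h0, zero_mul, eq_comm, sub_eq_zero] at h1
    exact (hQ x).pow_ne_one_of_pos_of_lt hk.ne' hkN h1
  have hself : ∀ μ, wordCoord b (p μ) (symmetrizedWord c b (p μ)) ≠ 0 := by
    intro μ
    rw [wordCoord_self]
    refine (hb _).repr_symmSum_ne_zero (hpg μ) fun x k hk hle => hgeom x k hk ?_
    rw [hpc μ] at hle
    exact hle.trans_lt (μ x).2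
  have hli : LinearIndependent 𝕜 fun μ => symmetrizedWord c b (p μ) := by
    -- The normalized coordinates at the representatives form a dual family, since contents separate
    -- supports.
    refine LinearIndependent.of_pairwise_dual_eq_zero_one _
      (fun μ => (wordCoord b (p μ) (symmetrizedWord c b (p μ)))⁻¹ • wordCoord b (p μ))
      (fun μ ν hne => ?_) fun μ => ?_
    · have hcont : content (p μ).2 ≠ content (p ν).2 := by
        rw [hpc, hpc]
        exact fun h => hne (funext fun x => Fin.ext (congrFun h x))
      beta_reduce
      rw [LinearMap.smul_apply, wordCoord_of_content_ne hb hcont, smul_zero]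
    · rw [LinearMap.smul_apply, smul_eq_mul, inv_mul_cancel₀ (hself μ)]
  have hspan : LinearMap.range ((DirectSum.lmap fun n => symmetrizer c n) ∘ₗ
      (TensorAlgebra.equivDirectSum (R := 𝕜) (M := V)).toLinearMap) =
        Submodule.span 𝕜 (Set.range fun μ => symmetrizedWord c b (p μ)) := by
    rw [LinearMap.range_comp_of_range_eq_top _ (LinearMap.range_eq_top.mpr
      (TensorAlgebra.equivDirectSum (R := 𝕜) (M := V)).surjective), range_lmap_symmetrizer b]
    apply le_antisymm
    · rw [Submodule.span_le]
      rintro _ ⟨⟨n, y⟩, rfl⟩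
      by_cases hy : ∀ x, content y x < N x
      · let μ : ∀ x, Fin (N x) := fun x => ⟨content y x, hy x⟩
        exact Submodule.span_mono (Set.singleton_subset_iff.mpr (Set.mem_range_self μ))
          (symmetrizedWord_mem_span hT hb (hpc μ).symm)
      · push Not at hy
        obtain ⟨x, hx⟩ := hy
        rw [SetLike.mem_coe, symmetrizedWord, symmetrizer_eq,
          (hb n).symmSum_eq_zero (hT n) (hN x) (hQ x) hx, map_zero]
        exact Submodule.zero_mem _
    · refine Submodule.span_mono ?_
      rintro _ ⟨μ, rfl⟩
      exact ⟨p μ, rfl⟩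
  have e : NicholsAlgebra c ≃ₗ[𝕜]
      Submodule.span 𝕜 (Set.range fun μ => symmetrizedWord c b (p μ)) :=
    (LinearMap.quotKerEquivRange _).trans (LinearEquiv.ofEq _ _ hspan)
  have : FiniteDimensional 𝕜 (Submodule.span 𝕜 (Set.range fun μ => symmetrizedWord c b (p μ))) :=
    FiniteDimensional.span_of_finite 𝕜 (Set.finite_range _)
  refine ⟨Module.Finite.equiv e.symm, ?_⟩
  rw [e.finrank_eq, finrank_span_eq_card hli, Fintype.card_pi]
  simp

end Dimension

end Nichols

theorem theorem3p22 {𝕜 : Type*} [Field 𝕜] [IsAlgClosed 𝕜] [CharZero 𝕜]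
    {X : Type*} [Fintype X] (hX : 2 ≤ Fintype.card X)
    (r : X × X → X × X) (hr : SetYB.IsSolution r) (hnd : SetYB.IsNonDegenerate r)
    (hinv : SetYB.IsInvolutive r)
    (R : X → X → 𝕜) (hR : SetYB.IsBraidingCoeff r R)
    {t : ℕ} (Y : Fin t → Finset X) (hY : SetYB.IsDecomposition r Y)
    (q : Fin t → 𝕜) (hq : ∀ k, ∀ i ∈ Y k, R (SetYB.diagonal hnd i) i = q k)
    (n : Fin t → ℕ) (hn : ∀ k, 2 ≤ n k) (hqn : ∀ k, IsPrimitiveRoot (q k) (n k))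
    (hRR : ∀ i j, i ≠ SetYB.diagonal hnd j →
      R i j * R (SetYB.sigma r i j) (SetYB.tau r j i) = 1) :
    FiniteDimensional 𝕜 (Nichols.NicholsAlgebra (SetYB.braiding r R)) ∧
      Module.finrank 𝕜 (Nichols.NicholsAlgebra (SetYB.braiding r R)) =
        ∏ k, n k ^ (Y k).card := by
  classical
  -- Here `k i` is the block of `i`; the order attached to the letter `i` is `n (k i)`, and grouping
  -- letters by block gives the stated product.
  choose k hk using hY.cover
  have hmem : ∀ i l, i ∈ Y l ↔ k i = l := fun i l =>
    ⟨fun h => by_contra fun hne => Finset.disjoint_left.mp (hY.disjoint _ _ hne) (hk i) h,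
      fun h => h ▸ hk i⟩
  have hprod : ∏ i, n (k i) = ∏ l, n l ^ (Y l).card := by
    rw [← Finset.prod_fiberwise Finset.univ k]
    refine Finset.prod_congr rfl fun l _ => ?_
    have hYl : Finset.univ.filter (fun i => k i = l) = Y l := by
      ext i
      simp [hmem]
    rw [hYl]
    exact Finset.prod_eq_pow_card fun i hi => by rw [(hmem i l).mp hi]
  have hc : ∀ i j, SetYB.braiding r R
      ((Finsupp.basisSingleOne : Module.Basis X 𝕜 (X →₀ 𝕜)) i ⊗ₜ Finsupp.basisSingleOne j) =
        R i j • (Finsupp.basisSingleOne (SetYB.sigma r i j) ⊗ₜ[𝕜]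
          Finsupp.basisSingleOne (SetYB.tau r j i)) := by
    intro i j
    simp only [Finsupp.coe_basisSingleOne]
    exact SetYB.braiding_single i j
  rw [← hprod]
  exact Nichols.finrank_nicholsAlgebra (hR.isBraidFamily hr hc)
    (SetYB.isSwapAction_strand hr hnd hinv hR hc hRR) (fun i => hn (k i))
    fun i => (hq (k i) i (hk i)).symm ▸ hqn (k i)
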